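/- Let $n\ge 1$. A real $n\times n$ matrix is totally nonnegative (totally positive) if all its minors, of all sizes, are nonnegative (positive); it is oscillatory if it is totally nonnegative and some positive integer power of it is totally positive. An $n\times n$ matrix $x$ is called block-triangular if for some $i\in\{1,\dots,n-1\}$ either $x_{hj}=0$ for all $h\le i<j$, or $x_{jh}=0$ for all $h\le i<j$. Let $E_{i,j}$ be the matrix units. For $t>0$ put $x_i(t)=I+tE_{i,i+1}$ and $x_{\bar i}(t)=I+tE_{i+1,i}$ for $1\le i\le n-1$, and, for the circled symbols $c_1,\dots,c_n$, put $x_{c_i}(t)=I+(t-1)E_{i,i}$ for $1\le i\le n$. For a word $\mathbf i=(i_1,\dots,i_l)$ in the alphabet $\{1,\dots,n-1,\,c_1,\dots,c_n,\,\bar 1,\dots,\overline{n-1}\}$ put $x_{\mathbf i}(t_1,\dots,t_l)=x_{i_1}(t_1)\cdots x_{i_l}(t_l)$. Let $B$ and $B_-$ be the subgroups of upper and lower triangular matrices in $GL_n(\mathbb C)$, and for permutations $u,v\in\mathcal S_n$, identified with permutation matrices, let $G^{u,v}=BuB\cap B_-vB_-$ be the corresponding double Bruhat cell. **Theorem.**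 For an invertible totally nonnegative $n\times n$ matrix $x$, the following are equivalent: (a) $x$ is oscillatory; (b) $x_{i,i+1}>0$ and $x_{i+1,i}>0$ for $i=1,\dots,n-1$; (c) $x^{n-1}$ is totally positive; (d) $x$ is not block-triangular; (e) $x=x_{\mathbf i}(t_1,\dots,t_l)$ for some positive $t_1,\dots,t_l$ and some word $\mathbf i$ that contains each of the symbols $1,\dots,n-1$ and $\bar 1,\dots,\overline{n-1}$ at least once; (f) $x$ lies in a double Bruhat cell $G^{u,v}$ such that, for every $i=1,\dots,n-1$, neither $u$ nor $v$ maps the set $\{1,\dots,i\}$ to itself. -/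

import Mathlib

open scoped MatrixGroups

namespace TotalPositivity

/-! ### Total nonnegativity, total positivity, oscillatory matrices

A minor with a `k`-element row set `I` and a `k`-element column set `J` is the determinant of the
submatrix cut out by the increasing enumerations `r` of `I` and `c` of `J`. -/

/-- All minors are nonnegative. -/
def IsTotallyNonnegative {n : ℕ} (A : Matrix (Fin n) (Fin n) ℝ) : Prop :=
  ∀ (k : ℕ) (r c : Fin k ↪o Fin n), 0 ≤ (A.submatrix r c).det

/-- All minors are positive. -/
def IsTotallyPositive {n : ℕ} (A : Matrix (Fin n) (Fin n) ℝ) : Prop :=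
  ∀ (k : ℕ) (r c : Fin k ↪o Fin n), 0 < (A.submatrix r c).det

/-- Totally nonnegative, and some (positive) power is totally positive. -/
def IsOscillatory {n : ℕ} (A : Matrix (Fin n) (Fin n) ℝ) : Prop :=
  IsTotallyNonnegative A ∧ ∃ m : ℕ, 0 < m ∧ IsTotallyPositive (A ^ m)

/-- For some `1 ≤ i ≤ n - 1`, either the upper right block (first `i` rows, last `n - i` columns)
or the lower left block (last `n - i` rows, first `i` columns) vanishes. -/
def IsBlockTriangular {n : ℕ} (A : Matrix (Fin n) (Fin n) ℝ) : Prop :=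
  ∃ i : ℕ, 1 ≤ i ∧ i < n ∧
    ((∀ h j : Fin n, h.val < i → i ≤ j.val → A h j = 0) ∨
      (∀ h j : Fin n, h.val < i → i ≤ j.val → A j h = 0))

/-! ### Words and the product map -/

/-- The alphabet `{1, …, n-1, ①, …, ⓝ, 1̄, …, (n-1)‾}`, with indices shifted to start at `0`. -/
inductive Letter (n : ℕ) : Type
  /-- the symbol `i` -/
  | plain (i : Fin (n - 1)) : Letter n
  /-- the circled symbol `i` -/
  | circled (i : Fin n) : Letter n
  /-- the barred symbol `i` -/
  | barred (i : Fin (n - 1)) : Letter n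

/-- The elementary Jacobi matrices `x_i(t) = I + t E_{i,i+1}`, `x_{ī}(t) = I + t E_{i+1,i}`, and
`I + (t - 1) E_{i,i}` for a circled `i`. -/
def elementaryJacobi {n : ℕ} (a : Letter n) (t : ℝ) : Matrix (Fin n) (Fin n) ℝ :=
  match a with
  | .plain i => 1 + Matrix.single ⟨i.val, by omega⟩ ⟨i.val + 1, by omega⟩ t
  | .circled i => 1 + Matrix.single i i (t - 1)
  | .barred i => 1 + Matrix.single ⟨i.val + 1, by omega⟩ ⟨i.val, by omega⟩ t

/-- `x_w(t₁, …, t_l) = x_{w₁}(t₁) ⋯ x_{w_l}(t_l)` for a word `w` of length `l`. -/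
def productMap {n l : ℕ} (w : Fin l → Letter n) (t : Fin l → ℝ) : Matrix (Fin n) (Fin n) ℝ :=
  (List.ofFn fun k => elementaryJacobi (w k) (t k)).prod

/-! ### Double Bruhat cells in `GL_n(ℂ)` -/

/-- The subgroup `B` of upper triangular matrices. -/
def upperBorel (n : ℕ) : Subgroup (GL (Fin n) ℂ) where
  carrier := {g | (g : Matrix (Fin n) (Fin n) ℂ).IsUpperTriangular}
  mul_mem' {a b} ha hb := by
    simpa using Matrix.BlockTriangular.mul ha hb
  one_mem' := by
    simpa using Matrix.blockTriangular_one
  inv_mem' {a} ha := by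
    have : Invertible (a : Matrix (Fin n) (Fin n) ℂ) := a.invertible
    change (a : Matrix (Fin n) (Fin n) ℂ).BlockTriangular _ at ha
    change ((a⁻¹ : GL (Fin n) ℂ) : Matrix (Fin n) (Fin n) ℂ).BlockTriangular _
    rw [Matrix.coe_units_inv]
    exact Matrix.blockTriangular_inv_of_blockTriangular ha

/-- The subgroup `B₋` of lower triangular matrices. -/
def lowerBorel (n : ℕ) : Subgroup (GL (Fin n) ℂ) where
  carrier := {g | (g : Matrix (Fin n) (Fin n) ℂ).IsLowerTriangular}
  mul_mem' {a b} ha hb := by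
    simpa using Matrix.BlockTriangular.mul ha hb
  one_mem' := by
    simpa using Matrix.blockTriangular_one
  inv_mem' {a} ha := by
    have : Invertible (a : Matrix (Fin n) (Fin n) ℂ) := a.invertible
    change (a : Matrix (Fin n) (Fin n) ℂ).BlockTriangular _ at ha
    change ((a⁻¹ : GL (Fin n) ℂ) : Matrix (Fin n) (Fin n) ℂ).BlockTriangular _
    rw [Matrix.coe_units_inv]
    exact Matrix.blockTriangular_inv_of_blockTriangular ha

/-- The permutation matrix of `w`, with entry `1` at `(w j, j)`, as an element of `GL_n(ℂ)`. -/
def permGL {n : ℕ} (w : Equiv.Perm (Fin n)) : GL (Fin n) ℂ :=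
  (Matrix.permMatrixHom (n := Fin n) (R := ℂ)).toHomUnits w

/-- The double Bruhat cell `G^{u,v} = B u B ∩ B₋ v B₋`. -/
def doubleBruhatCell {n : ℕ} (u v : Equiv.Perm (Fin n)) : Set (GL (Fin n) ℂ) :=
  DoubleCoset.doubleCoset (permGL u) (upperBorel n : Set (GL (Fin n) ℂ)) (upperBorel n) ∩
    DoubleCoset.doubleCoset (permGL v) (lowerBorel n : Set (GL (Fin n) ℂ)) (lowerBorel n)

/-- `w` does not map any of the sets `{1, …, i}`, `1 ≤ i ≤ n - 1`, to itself. -/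
def FixesNoInitialSegment {n : ℕ} (w : Equiv.Perm (Fin n)) : Prop :=
  ∀ i : ℕ, 1 ≤ i → i < n → w '' {k : Fin n | k.val < i} ≠ {k : Fin n | k.val < i}

end TotalPositivity

/-!
If `x` is not block-triangular, then it factors into elementary Jacobi matrices with all plain and
barred letters; such a factorization makes the entries next to the diagonal and all minors of
`x ^ (n - 1)` positive; and a block-triangular matrix has neither property, nor any totally positive
power. Double Bruhat cells are compared with block-triangularity directly.

*Factorization.* By the Loewner–Whitney theorem (`IsTotallyNonnegative.isJacobiProduct`) `x` is a
product of elementary Jacobi matrices with positive parameters. If the word lacked a plain or a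
barred letter, all factors, and with them `x`, would be block-triangular for the same block
decomposition. The factorization comes from Neville elimination, with the transpose taking care of
the entries above the diagonal. What has to be shown is that subtracting `ρ` times row `a` from row
`a + 1`, with `ρ` the pivot quotient of the first column that is not yet zero below the diagonal,
keeps all minors nonnegative, that is, that replacing row `a` by row `a + 1` multiplies every minor
by at least `ρ`. For minors with first row `a` the difference of the two sides is, up to a positive
factor, zero or a minor expanded along the pivot column (`pivot_mul_det_le`). A three-term Plücker relation
(`det_mul_det_updateRow`) shows that the factor does not decrease when a first row and a first
column are added, and so reduces the other minors to these (`mul_det_le_det_update`). The division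
this needs is legitimate because an invertible totally nonnegative matrix stays invertible after
deletion of its first row and column (`det_succ_pos`), by induction with Schur complements.

*Positivity.* Left multiplication by `1 + t E_{ab}` adds to a minor with row `a` the
`t`-fold of the minor in which row `a` is replaced by row `b`. For a word containing all plain and
barred letters, a minor of the product is therefore positive as soon as its row set can be carried
to its column set by moves to neighbouring places that can be performed in any order
(`det_jacobiProd_mul_pos`). An arbitrary row set can be carried to an arbitrary column set in
`n - 1` rounds of such moves (`schedule`), so all minors of `x ^ (n - 1)` are positive.

*Bruhat cells.* By the Bruhat decomposition every `x` lies in some `B u B` and in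
some `B₋ v B₋`. The block upper triangular matrices of a given shape form a ring containing `B`, so
`x ∈ B u B` is one of them exactly if the permutation matrix of `u` is, which means that `u`
preserves the initial segment in question; likewise for `v`.
-/

namespace TotalPositivity

open Matrix

variable {n : ℕ}

/-! ### Minors and elementary row operations -/

theorem IsTotallyNonnegative.det_nonneg {A : Matrix (Fin n) (Fin n) ℝ}
    (hA : IsTotallyNonnegative A) {k : ℕ} {f g : Fin k → Fin n} (hf : StrictMono f)
    (hg : StrictMono g) : 0 ≤ (A.submatrix f g).det :=
  hA k (OrderEmbedding.ofStrictMono f hf) (OrderEmbedding.ofStrictMono g hg)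

theorem isTotallyNonnegative_of_strictMono {A : Matrix (Fin n) (Fin n) ℝ}
    (h : ∀ (k : ℕ) (f g : Fin k → Fin n), StrictMono f → StrictMono g →
      0 ≤ (A.submatrix f g).det) : IsTotallyNonnegative A :=
  fun k r c => h k r c r.strictMono c.strictMono

theorem IsTotallyNonnegative.apply_nonneg {A : Matrix (Fin n) (Fin n) ℝ}
    (hA : IsTotallyNonnegative A) (i j : Fin n) : 0 ≤ A i j := by
  have := hA.det_nonneg (k := 1) (f := fun _ => i) (g := fun _ => j)
    (Subsingleton.strictMono _) (Subsingleton.strictMono _)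
  simpa using this

theorem strictMono_vecCons {a b : Fin n} (h : a < b) : StrictMono ![a, b] := by
  intro i j hij
  fin_cases i <;> fin_cases j <;> simp_all

theorem IsTotallyNonnegative.mul_le_mul {A : Matrix (Fin n) (Fin n) ℝ}
    (hA : IsTotallyNonnegative A) {i i' j j' : Fin n} (hi : i < i') (hj : j < j') :
    A i j' * A i' j ≤ A i j * A i' j' := by
  have := hA.det_nonneg (strictMono_vecCons hi) (strictMono_vecCons hj)
  rw [det_fin_two] at this
  simpa using this

theorem IsTotallyNonnegative.submatrix {A : Matrix (Fin n) (Fin n) ℝ}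
    (hA : IsTotallyNonnegative A) {k : ℕ} {f g : Fin k → Fin n} (hf : StrictMono f)
    (hg : StrictMono g) : IsTotallyNonnegative (A.submatrix f g) :=
  isTotallyNonnegative_of_strictMono fun _ _ _ hr hc => hA.det_nonneg (hf.comp hr) (hg.comp hc)

theorem IsTotallyNonnegative.transpose {A : Matrix (Fin n) (Fin n) ℝ}
    (hA : IsTotallyNonnegative A) : IsTotallyNonnegative Aᵀ :=
  isTotallyNonnegative_of_strictMono fun _ f g hf hg => by
    rw [← transpose_submatrix, det_transpose]
    exact hA.det_nonneg hg hf

theorem isTotallyNonnegative_one : IsTotallyNonnegative (1 : Matrix (Fin n) (Fin n) ℝ) := by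
  refine isTotallyNonnegative_of_strictMono fun k f g hf hg => ?_
  by_cases h : ∀ i, ∃ j, g j = f i
  · -- equal row and column sets: two increasing enumerations of one set coincide
    have hfg : f = g := by
      refine (hf.range_inj hg).1 ?_
      refine Set.eq_of_subset_of_ncard_le (by rintro _ ⟨i, rfl⟩; exact h i) ?_ (Set.toFinite _)
      rw [← Set.image_univ, ← Set.image_univ, Set.ncard_image_of_injective _ hf.injective,
        Set.ncard_image_of_injective _ hg.injective]
    rw [hfg, submatrix_one _ hg.injective, det_one]
    exact zero_le_one
  · push Not at h
    obtain ⟨i, hi⟩ := h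
    rw [det_eq_zero_of_row_eq_zero i]
    intro j
    simp [one_apply, (hi j).symm]

theorem transvection_mul_eq_updateRow (A : Matrix (Fin n) (Fin n) ℝ) (a b : Fin n) (t : ℝ) :
    (1 + single a b t) * A = A.updateRow a (A a + t • A b) := by
  ext i j
  by_cases h : i = a
  · subst h
    simp [add_mul]
  · simp [add_mul, h]

/-- Left multiplication by `1 + t E_{ab}` does not change minors that avoid row `a`. -/
theorem det_submatrix_transvection_mul_of_notMem (A : Matrix (Fin n) (Fin n) ℝ) (a b : Fin n)
    (t : ℝ) {k : ℕ} {f g : Fin k → Fin n} (hf : ∀ m, f m ≠ a) :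
    (((1 + single a b t) * A).submatrix f g).det = (A.submatrix f g).det := by
  rw [transvection_mul_eq_updateRow]
  congr 1
  ext i j
  simp [hf i]

theorem det_submatrix_transvection_mul (A : Matrix (Fin n) (Fin n) ℝ) (a b : Fin n)
    (t : ℝ) {k : ℕ} {f g : Fin k → Fin n} (hf : Function.Injective f) {m : Fin k} (hm : f m = a) :
    (((1 + single a b t) * A).submatrix f g).det =
      (A.submatrix f g).det + t * (A.submatrix (Function.update f m b) g).det := by
  have h1 : ((1 + single a b t) * A).submatrix f g = (A.submatrix f g).updateRow m
      ((A.submatrix f g) m + t • fun j => A b (g j)) := by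
    rw [transvection_mul_eq_updateRow]
    ext i j
    by_cases h : i = m
    · subst h
      simp [hm]
    · have : f i ≠ a := fun h' => h (hf (h'.trans hm.symm))
      simp [h, this]
  have h2 : A.submatrix (Function.update f m b) g =
      (A.submatrix f g).updateRow m (fun j => A b (g j)) := by
    ext i j
    by_cases h : i = m
    · subst h
      simp
    · simp [h]
  rw [h1, h2, det_updateRow_add, det_updateRow_smul, updateRow_eq_self]

theorem det_submatrix_update_of_mem (A : Matrix (Fin n) (Fin n) ℝ) {k : ℕ}
    {f g : Fin k → Fin n} {m m' : Fin k} (h : m' ≠ m) :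
    (A.submatrix (Function.update f m (f m')) g).det = 0 :=
  det_zero_of_row_eq h (by ext j; simp [h])

/-- Moving one element of an increasing sequence to a free neighbouring place keeps it
increasing. -/
theorem strictMono_update {k : ℕ} {f : Fin k → Fin n} (hf : StrictMono f) {m : Fin k} {b : Fin n}
    (hb : ∀ i, f i ≠ b) (hab : b.val = (f m).val + 1 ∨ (f m).val = b.val + 1) :
    StrictMono (Function.update f m b) := by
  intro i j hij
  have h0 := hf hij
  have hi := hb i
  have hj := hb j
  rw [Fin.lt_def] at h0 ⊢
  rw [Ne, Fin.ext_iff] at hi hj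
  by_cases h1 : i = m
  · subst h1
    simp [hij.ne']
    omega
  · by_cases h2 : j = m
    · subst h2
      simp [h1]
      omega
    · simpa [h1, h2] using h0

theorem IsTotallyNonnegative.det_update_nonneg {A : Matrix (Fin n) (Fin n) ℝ}
    (hA : IsTotallyNonnegative A) {k : ℕ} {f g : Fin k → Fin n} (hf : StrictMono f)
    (hg : StrictMono g) {m : Fin k} {b : Fin n}
    (hab : b.val = (f m).val + 1 ∨ (f m).val = b.val + 1) :
    0 ≤ (A.submatrix (Function.update f m b) g).det := by
  by_cases h : ∃ i, f i = b
  · obtain ⟨i, rfl⟩ := h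
    rw [det_submatrix_update_of_mem]
    rintro rfl
    omega
  · push Not at h
    exact hA.det_nonneg (strictMono_update hf h hab) hg

/-! ### Products of elementary Jacobi matrices -/

/-- The row that left multiplication by the elementary Jacobi matrix of a letter changes. -/
def Letter.source : Letter n → Fin n
  | .plain i => ⟨i.val, by omega⟩
  | .circled i => i
  | .barred i => ⟨i.val + 1, by omega⟩

/-- The row that left multiplication by the elementary Jacobi matrix of a letter adds to the
row `source`. For a circled letter, which only rescales a row, both are this row. -/
def Letter.target : Letter n → Fin n
  | .plain i => ⟨i.val + 1, by omega⟩
  | .circled i => i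
  | .barred i => ⟨i.val, by omega⟩

theorem elementaryJacobi_of_ne {a : Letter n} (h : a.source ≠ a.target) (t : ℝ) :
    elementaryJacobi a t = 1 + single a.source a.target t := by
  cases a <;> first | rfl | exact absurd rfl h

theorem Letter.adjacent {a : Letter n} (h : a.source ≠ a.target) :
    a.target.val = a.source.val + 1 ∨ a.source.val = a.target.val + 1 := by
  cases a <;> simp_all [Letter.source, Letter.target]

theorem Letter.eq_circled {a : Letter n} (h : a.source = a.target) :
    ∃ i, a = .circled i := by
  cases a <;> simp_all [Letter.source, Letter.target]

/-- Minors of a totally nonnegative matrix do not become negative, and positive ones stay positive,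
under left multiplication by an elementary Jacobi matrix. -/
theorem exists_le_det_elementaryJacobi_mul {A : Matrix (Fin n) (Fin n) ℝ}
    (hA : IsTotallyNonnegative A) (a : Letter n) {t : ℝ} (ht : 0 < t) {k : ℕ}
    {f g : Fin k → Fin n} (hf : StrictMono f) (hg : StrictMono g) :
    ∃ s : ℝ, 0 < s ∧
      s * (A.submatrix f g).det ≤ ((elementaryJacobi a t * A).submatrix f g).det := by
  by_cases h : a.source = a.target
  · obtain ⟨i, rfl⟩ := Letter.eq_circled h
    change ∃ s : ℝ, 0 < s ∧
      s * (A.submatrix f g).det ≤ (((1 + single i i (t - 1)) * A).submatrix f g).det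
    by_cases hi : ∃ m, f m = i
    · obtain ⟨m, hm⟩ := hi
      refine ⟨t, ht, ?_⟩
      rw [det_submatrix_transvection_mul A i i (t - 1) hf.injective hm, ← hm,
        Function.update_eq_self]
      apply le_of_eq
      ring
    · push Not at hi
      refine ⟨1, one_pos, ?_⟩
      rw [det_submatrix_transvection_mul_of_notMem _ _ _ _ hi, one_mul]
  · refine ⟨1, one_pos, ?_⟩
    rw [one_mul, elementaryJacobi_of_ne h]
    by_cases hi : ∃ m, f m = a.source
    · obtain ⟨m, hm⟩ := hi
      rw [det_submatrix_transvection_mul A _ _ t hf.injective hm]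
      have := hA.det_update_nonneg hf hg (m := m) (b := a.target)
        (by rw [hm]; exact Letter.adjacent h)
      have := mul_nonneg ht.le this
      linarith
    · push Not at hi
      rw [det_submatrix_transvection_mul_of_notMem _ _ _ _ hi]

/-- The product of the elementary Jacobi matrices of a list of letters with parameters. -/
def jacobiProd (L : List (Letter n × ℝ)) : Matrix (Fin n) (Fin n) ℝ :=
  (L.map fun p => elementaryJacobi p.1 p.2).prod

@[simp] theorem jacobiProd_nil : jacobiProd ([] : List (Letter n × ℝ)) = 1 := rfl

@[simp] theorem jacobiProd_cons (p : Letter n × ℝ) (L : List (Letter n × ℝ)) :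
    jacobiProd (p :: L) = elementaryJacobi p.1 p.2 * jacobiProd L := by
  simp [jacobiProd]

theorem jacobiProd_ofFn {l : ℕ} (w : Fin l → Letter n) (t : Fin l → ℝ) :
    jacobiProd (List.ofFn fun k => (w k, t k)) = productMap w t := by
  rw [jacobiProd, productMap, List.map_ofFn]
  rfl

theorem IsTotallyNonnegative.jacobiProd_mul {A : Matrix (Fin n) (Fin n) ℝ}
    (hA : IsTotallyNonnegative A) {L : List (Letter n × ℝ)} (hL : ∀ p ∈ L, 0 < p.2) :
    IsTotallyNonnegative (jacobiProd L * A) := by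
  induction L with
  | nil => simpa using hA
  | cons p L ih =>
    have ih' := ih fun q hq => hL q (List.mem_cons_of_mem _ hq)
    refine isTotallyNonnegative_of_strictMono fun k f g hf hg => ?_
    obtain ⟨s, hs, h⟩ := exists_le_det_elementaryJacobi_mul ih' p.1 (hL p List.mem_cons_self) hf hg
    rw [jacobiProd_cons, Matrix.mul_assoc]
    exact (mul_nonneg hs.le (ih'.det_nonneg hf hg)).trans h

/-- Simultaneous moves of the row set. If the rows `f` can be carried to the rows `f'` by moves to
neighbouring places that do not get into each other's way, so that they may be performed in any
order, and each move is the move of some letter of the word, then positivity of the minor of `A`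
with rows `f'` gives positivity of the minor of `jacobiProd L * A` with rows `f`. -/
theorem det_jacobiProd_mul_pos {A : Matrix (Fin n) (Fin n) ℝ} (hA : IsTotallyNonnegative A)
    {L : List (Letter n × ℝ)} (hL : ∀ p ∈ L, 0 < p.2) {k : ℕ} {f f' g : Fin k → Fin n}
    (hf : StrictMono f) (hf' : StrictMono f') (hg : StrictMono g)
    (hsep : ∀ i j, i < j → f i < f' j ∧ f' i < f j)
    (hmove : ∀ m, f m ≠ f' m → ∃ p ∈ L, p.1.source = f m ∧ p.1.target = f' m)
    (hpos : 0 < (A.submatrix f' g).det) :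
    0 < ((jacobiProd L * A).submatrix f g).det := by
  induction L generalizing f with
  | nil =>
    have : f = f' := by
      funext m
      by_contra h
      simpa using hmove m h
    simpa [this] using hpos
  | cons p L ih =>
    have hL' : ∀ q ∈ L, 0 < q.2 := fun q hq => hL q (List.mem_cons_of_mem _ hq)
    have hp : 0 < p.2 := hL p List.mem_cons_self
    have hTN := hA.jacobiProd_mul hL'
    rw [jacobiProd_cons, Matrix.mul_assoc]
    by_cases h : ∃ m, f m ≠ f' m ∧ p.1.source = f m ∧ p.1.target = f' m
    · obtain ⟨m, hne, hs, ht⟩ := h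
      have hf1 : StrictMono (Function.update f m (f' m)) := by
        intro i j hij
        by_cases h1 : i = m
        · subst h1
          simpa [hij.ne'] using (hsep _ _ hij).2
        · by_cases h2 : j = m
          · subst h2
            simpa [h1] using (hsep _ _ hij).1
          · simpa [h1, h2] using hf hij
      have key := ih hL' hf1 ?_ ?_
      · rw [elementaryJacobi_of_ne (by rw [hs, ht]; exact hne),
          det_submatrix_transvection_mul _ _ _ _ hf.injective hs.symm, ht]
        have := hTN.det_nonneg hf hg
        have := mul_pos hp key
        linarith
      · intro i j hij
        by_cases h1 : i = m
        · subst h1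
          simpa [hij.ne'] using ⟨hf' hij, (hsep _ _ hij).2⟩
        · by_cases h2 : j = m
          · subst h2
            simpa [h1] using ⟨(hsep _ _ hij).1, hf' hij⟩
          · simpa [h1, h2] using hsep _ _ hij
      · intro i hi
        have him : i ≠ m := by
          rintro rfl
          simp at hi
        simp only [Function.update_of_ne him] at hi ⊢
        obtain ⟨q, hq, hqs, hqt⟩ := hmove i hi
        rcases List.mem_cons.1 hq with rfl | hq
        · exact absurd (hf.injective (hqs.symm.trans hs)) him
        · exact ⟨q, hq, hqs, hqt⟩
    · have key := ih hL' hf hsep fun m hm => by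
        obtain ⟨q, hq, hqs, hqt⟩ := hmove m hm
        rcases List.mem_cons.1 hq with rfl | hq
        · exact absurd ⟨m, hm, hqs, hqt⟩ h
        · exact ⟨q, hq, hqs, hqt⟩
      obtain ⟨s, hs0, hs⟩ := exists_le_det_elementaryJacobi_mul hTN p.1 hp hf hg
      exact (mul_pos hs0 key).trans_le hs

/-! ### Words containing all plain and barred letters -/

/-- The word contains every plain and every barred letter. -/
def HasFullSupport (L : List (Letter n × ℝ)) : Prop :=
  ∀ i : Fin (n - 1), (∃ p ∈ L, p.1 = .plain i) ∧ ∃ p ∈ L, p.1 = .barred i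

theorem HasFullSupport.exists_move {L : List (Letter n × ℝ)} (hL : HasFullSupport L)
    {a b : Fin n} (hab : b.val = a.val + 1 ∨ a.val = b.val + 1) :
    ∃ p ∈ L, p.1.source = a ∧ p.1.target = b := by
  rcases hab with h | h
  · obtain ⟨p, hp, hpi⟩ := (hL ⟨a.val, by omega⟩).1
    refine ⟨p, hp, ?_, ?_⟩ <;> simp [hpi, Letter.source, Letter.target, Fin.ext_iff, h]
  · obtain ⟨p, hp, hpi⟩ := (hL ⟨b.val, by omega⟩).2
    refine ⟨p, hp, ?_, ?_⟩ <;> simp [hpi, Letter.source, Letter.target, Fin.ext_iff, h]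

theorem jacobiProd_apply_pos {L : List (Letter n × ℝ)} (hL : ∀ p ∈ L, 0 < p.2)
    (hfull : HasFullSupport L) {a b : Fin n} (hab : b.val = a.val + 1 ∨ a.val = b.val + 1) :
    0 < jacobiProd L a b := by
  have := det_jacobiProd_mul_pos (A := 1) isTotallyNonnegative_one hL (k := 1)
    (f := fun _ => a) (f' := fun _ => b) (g := fun _ => b) (Subsingleton.strictMono _)
    (Subsingleton.strictMono _) (Subsingleton.strictMono _) (fun i j h => by omega)
    (fun _ _ => hfull.exists_move hab) (by simp)
  simpa using this

theorem le_val_of_strictMono {k : ℕ} {f : Fin k → Fin n} (hf : StrictMono f) (m : Fin k) :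
    m.val ≤ (f m).val := by
  obtain ⟨m, hm⟩ := m
  induction m with
  | zero => exact Nat.zero_le _
  | succ m ih =>
    have h1 := ih (by omega)
    have h2 := hf (show (⟨m, by omega⟩ : Fin k) < ⟨m + 1, hm⟩ from Nat.lt_succ_self m)
    rw [Fin.lt_def] at h2
    simp only at h1 ⊢
    omega

theorem val_add_le_of_strictMono {k : ℕ} {f : Fin k → Fin n} (hf : StrictMono f) (m : Fin k) :
    (f m).val + k ≤ n + m.val := by
  have hf' : StrictMono fun i : Fin k => (f i.rev).rev := by
    intro i j hij
    simpa using hf (Fin.rev_lt_rev.2 hij)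
  have h := le_val_of_strictMono hf' m.rev
  simp only [Fin.rev_rev, Fin.val_rev] at h
  omega

/-- The schedule that carries the row set `f` to the row set `g` in `n - 1` steps: the position of
the `m`-th element after `s` steps. An element that has to go up follows the line
`2m + s - (k - 1)` between its two end positions, one that has to go down the mirror image of such
a line. The slope `2` in `m` keeps neighbouring moving elements two places apart, and the lines
start before `f` at `s = 0` and arrive beyond `g` at `s = n - 1`. -/
def schedule (n k s m a b : ℕ) : ℕ :=
  if a ≤ b then max a (min b (2 * m + s + 1 - k)) else min a (max b (n + 2 * m - k - s))

theorem schedule_lt {n k s m a b : ℕ} (ha : a < n) (hb : b < n) : schedule n k s m a b < n := by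
  unfold schedule
  split_ifs <;> omega

theorem schedule_zero {n k m a b : ℕ} (hm : m < k) (h1 : m ≤ a) (h2 : a + k ≤ n + m) :
    schedule n k 0 m a b = a := by
  unfold schedule
  split_ifs <;> omega

theorem schedule_last {n k m a b : ℕ} (hm : m < k) (hb : b < n) (h1 : m ≤ b)
    (h2 : b + k ≤ n + m) : schedule n k (n - 1) m a b = b := by
  unfold schedule
  split_ifs <;> omega

theorem schedule_succ (n k s m a b : ℕ) :
    schedule n k (s + 1) m a b = schedule n k s m a b ∨
      schedule n k (s + 1) m a b = schedule n k s m a b + 1 ∨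
      schedule n k s m a b = schedule n k (s + 1) m a b + 1 := by
  unfold schedule
  split_ifs <;> omega

theorem schedule_lt_schedule {n k s s' m m' a a' b b' : ℕ} (hm : m < m') (ha : a < a')
    (hb : b < b') (h : s ≤ s' + 1) (h' : s' ≤ s + 1) :
    schedule n k s m a b < schedule n k s' m' a' b' := by
  unfold schedule
  split_ifs <;> omega

/-- A word with full support gives a matrix whose `(n-1)`-st power is totally positive: each of the
`n - 1` factors carries out one step of the schedule. -/
theorem isTotallyPositive_jacobiProd_pow {L : List (Letter n × ℝ)} (hL : ∀ p ∈ L, 0 < p.2)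
    (hfull : HasFullSupport L) : IsTotallyPositive (jacobiProd L ^ (n - 1)) := by
  intro k f g
  have hTN : ∀ r : ℕ, IsTotallyNonnegative (jacobiProd L ^ r) := by
    intro r
    induction r with
    | zero => exact isTotallyNonnegative_one
    | succ r ih =>
      rw [pow_succ']
      exact ih.jacobiProd_mul hL
  let pos : ℕ → Fin k → Fin n := fun s m =>
    ⟨schedule n k s m (f m) (g m), schedule_lt (f m).2 (g m).2⟩
  have hlt : ∀ s s' : ℕ, s ≤ s' + 1 → s' ≤ s + 1 → ∀ i j, i < j → pos s i < pos s' j :=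
    fun s s' h h' i j hij => schedule_lt_schedule hij (f.strictMono hij) (g.strictMono hij) h h'
  have hmono : ∀ s, StrictMono (pos s) := fun s i j hij =>
    hlt s s (by omega) (by omega) i j hij
  have h0 : pos 0 = f := funext fun m => Fin.ext <| schedule_zero m.2
    (le_val_of_strictMono f.strictMono m) (val_add_le_of_strictMono f.strictMono m)
  have hlast : pos (n - 1) = g := funext fun m => Fin.ext <| schedule_last m.2 (g m).2
    (le_val_of_strictMono g.strictMono m) (val_add_le_of_strictMono g.strictMono m)
  have main : ∀ r, r ≤ n - 1 → 0 < ((jacobiProd L ^ r).submatrix (pos (n - 1 - r)) g).det := by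
    intro r
    induction r with
    | zero =>
      intro _
      rw [Nat.sub_zero, hlast, pow_zero, submatrix_one _ g.injective, det_one]
      exact one_pos
    | succ r ih =>
      intro hr
      rw [pow_succ']
      have hs : n - 1 - r = n - 1 - (r + 1) + 1 := by omega
      refine det_jacobiProd_mul_pos (hTN r) hL (hmono _) (hmono _) g.strictMono ?_ ?_
        (ih (by omega))
      · intro i j hij
        exact ⟨hlt _ _ (by omega) (by omega) i j hij, hlt _ _ (by omega) (by omega) i j hij⟩
      · intro m hm
        apply hfull.exists_move
        have := schedule_succ n k (n - 1 - (r + 1)) m (f m) (g m)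
        rw [Ne, Fin.ext_iff] at hm
        simp only [pos, hs] at hm ⊢
        omega
  have := main (n - 1) le_rfl
  rwa [Nat.sub_self, h0] at this

/-! ### Corner minors of invertible totally nonnegative matrices -/

theorem strictMono_snoc {k m : ℕ} {f : Fin k → Fin m} (hf : StrictMono f) :
    StrictMono (Fin.snoc (fun i => (f i).castSucc) (Fin.last m) : Fin (k + 1) → Fin (m + 1)) := by
  intro i j hij
  induction j using Fin.lastCases with
  | last =>
    induction i using Fin.lastCases with
    | last => exact absurd hij (lt_irrefl _)
    | cast i => simp
  | cast j =>
    induction i using Fin.lastCases with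
    | last => exact absurd (hij.trans (Fin.castSucc_lt_last j)) (lt_irrefl _)
    | cast i => simpa using hf (Fin.castSucc_lt_castSucc_iff.1 hij)

/-- The Schur complement of the last diagonal entry. -/
noncomputable def schurLast {m : ℕ} (M : Matrix (Fin (m + 1)) (Fin (m + 1)) ℝ) :
    Matrix (Fin m) (Fin m) ℝ :=
  of fun i j => M i.castSucc j.castSucc -
    M i.castSucc (Fin.last m) * M (Fin.last m) j.castSucc / M (Fin.last m) (Fin.last m)

theorem det_eq_mul_det_schurLast {m : ℕ} (M : Matrix (Fin (m + 1)) (Fin (m + 1)) ℝ)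
    (h : M (Fin.last m) (Fin.last m) ≠ 0) :
    M.det = M (Fin.last m) (Fin.last m) * (schurLast M).det := by
  set d := M (Fin.last m) (Fin.last m) with hd
  let c : Fin (m + 1) → ℝ := Fin.snoc (fun i => M i.castSucc (Fin.last m) / d) 0
  let B : Matrix (Fin (m + 1)) (Fin (m + 1)) ℝ := of fun i j => M i j - c i * M (Fin.last m) j
  have hB : M.det = B.det := by
    refine det_eq_of_forall_row_eq_smul_add_const c (Fin.last m) (by simp [c]) fun i j => ?_
    simp [B, c]
  rw [hB, det_succ_column B (Fin.last m), Finset.sum_eq_single (Fin.last m)]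
  · have h1 : B (Fin.last m) (Fin.last m) = d := by simp [B, c, hd]
    have h2 : B.submatrix (Fin.last m).succAbove (Fin.last m).succAbove = schurLast M := by
      ext i j
      simp only [submatrix_apply, Fin.succAbove_last, B, schurLast, of_apply, c, Fin.snoc_castSucc,
        ← hd]
      ring
    rw [h1, h2, Even.neg_one_pow ⟨_, rfl⟩, one_mul]
  · intro i _ hi
    induction i using Fin.lastCases with
    | last => exact absurd rfl hi
    | cast i =>
      have : B i.castSucc (Fin.last m) = 0 := by
        simp only [B, c, of_apply, Fin.snoc_castSucc, ← hd]
        field_simp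
        ring
      rw [this]
      ring
  · simp

theorem det_schurLast_submatrix {m : ℕ} (M : Matrix (Fin (m + 1)) (Fin (m + 1)) ℝ)
    (h : M (Fin.last m) (Fin.last m) ≠ 0) {k : ℕ} (f g : Fin k → Fin m) :
    (M.submatrix (Fin.snoc (fun i => (f i).castSucc) (Fin.last m) : Fin (k + 1) → Fin (m + 1))
      (Fin.snoc (fun i => (g i).castSucc) (Fin.last m) : Fin (k + 1) → Fin (m + 1))).det =
      M (Fin.last m) (Fin.last m) * ((schurLast M).submatrix f g).det := by
  rw [det_eq_mul_det_schurLast _ (by simpa using h)]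
  simp only [submatrix_apply, Fin.snoc_last]
  congr 2
  ext i j
  simp [schurLast]

/-- The last diagonal entry of an invertible totally nonnegative matrix is positive: if it were
zero, nonzero entries in the last row and in the last column would form a negative `2 × 2` minor. -/
theorem IsTotallyNonnegative.apply_last_pos {m : ℕ} {M : Matrix (Fin (m + 1)) (Fin (m + 1)) ℝ}
    (hM : IsTotallyNonnegative M) (hdet : M.det ≠ 0) : 0 < M (Fin.last m) (Fin.last m) := by
  refine lt_of_le_of_ne (hM.apply_nonneg _ _) fun h => hdet ?_
  by_cases hrow : ∃ j, M (Fin.last m) j ≠ 0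
  · obtain ⟨j, hj⟩ := hrow
    have hjl : j < Fin.last m := Fin.lt_last_iff_ne_last.2 fun h' => hj (by rw [h', ← h])
    refine det_eq_zero_of_column_eq_zero (Fin.last m) fun i => ?_
    rcases (Fin.le_last i).eq_or_lt with rfl | hi
    · exact h.symm
    · have h1 := hM.mul_le_mul hi hjl
      rw [← h, mul_zero] at h1
      have h2 : 0 < M (Fin.last m) j := lt_of_le_of_ne (hM.apply_nonneg _ _) (Ne.symm hj)
      exact le_antisymm (nonpos_of_mul_nonpos_left h1 h2) (hM.apply_nonneg _ _)
  · push Not at hrow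
    exact det_eq_zero_of_row_eq_zero _ hrow

/-- Deleting the first row and the first column of an invertible totally nonnegative matrix leaves
an invertible one. -/
theorem IsTotallyNonnegative.det_succ_pos {m : ℕ} {M : Matrix (Fin (m + 1)) (Fin (m + 1)) ℝ}
    (hM : IsTotallyNonnegative M) (hdet : M.det ≠ 0) :
    0 < (M.submatrix Fin.succ Fin.succ).det := by
  induction m with
  | zero => simp
  | succ m ih =>
    have hpos := hM.apply_last_pos hdet
    have hS : IsTotallyNonnegative (schurLast M) :=
      isTotallyNonnegative_of_strictMono fun k f g hf hg => by
        have := hM.det_nonneg (strictMono_snoc hf) (strictMono_snoc hg)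
        rw [det_schurLast_submatrix M hpos.ne'] at this
        exact nonneg_of_mul_nonneg_right this hpos
    have hSdet : (schurLast M).det ≠ 0 := fun h => hdet <| by
      rw [det_eq_mul_det_schurLast M hpos.ne', h, mul_zero]
    have key := mul_pos hpos (ih hS hSdet)
    rw [← det_schurLast_submatrix M hpos.ne'] at key
    have hsucc : (Fin.snoc (fun i : Fin m => i.succ.castSucc) (Fin.last (m + 1)) :
        Fin (m + 1) → Fin (m + 2)) = Fin.succ := by
      funext i
      induction i using Fin.lastCases <;> simp
    rwa [hsucc] at key

/-! ### A three-term Plücker relation -/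

/-- The three-term Plücker relation for the rows `M p`, `M q`, `e`, `v` over the remaining rows
of `M`. It is Cramer's rule for `e` in terms of the rows of `M`, put into a determinant. -/
theorem det_mul_det_updateRow {ι R : Type*} [Fintype ι] [DecidableEq ι] [CommRing R]
    (M : Matrix ι ι R) {p q : ι} (hpq : p ≠ q) (e v : ι → R) :
    M.det * ((M.updateRow p e).updateRow q v).det =
      (M.updateRow p e).det * (M.updateRow q v).det +
        (M.updateRow q e).det * ((M.updateRow p (M q)).updateRow q v).det := by
  have hswap : ∀ u : ι → R, (M.updateRow p u).updateRow q v = (M.updateRow q v).updateRow p u :=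
    fun u => updateRow_comm _ hpq _ _
  have hcramer : M.det • e = ∑ i, (M.updateRow i e).det • M i := by
    have h := mulVec_cramer Mᵀ e
    rw [det_transpose] at h
    rw [← h]
    ext j
    simp [mulVec, dotProduct, cramer_transpose_apply, mul_comm]
  have hsum : ∀ s : Finset ι,
      ((M.updateRow q v).updateRow p (∑ i ∈ s, (M.updateRow i e).det • M i)).det =
        ∑ i ∈ s, (M.updateRow i e).det * ((M.updateRow q v).updateRow p (M i)).det := by
    intro s
    induction s using Finset.induction_on with
    | empty => simpa using det_eq_zero_of_row_eq_zero p (by simp)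
    | insert i s hi ih =>
      rw [Finset.sum_insert hi, Finset.sum_insert hi, det_updateRow_add, det_updateRow_smul, ih]
  rw [hswap, hswap, ← det_updateRow_smul, hcramer, hsum,
    Finset.sum_eq_add_of_mem p q (Finset.mem_univ _) (Finset.mem_univ _) hpq]
  · congr 2
    have : M p = (M.updateRow q v) p := by rw [updateRow_ne hpq]
    rw [this, updateRow_eq_self]
  · rintro i - ⟨hip, hiq⟩
    have : ((M.updateRow q v).updateRow p (M i)).det = 0 := det_zero_of_row_eq hip <| by
      rw [updateRow_self, updateRow_ne hip, updateRow_ne hiq]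
    rw [this, mul_zero]

theorem det_submatrix_cons (x : Matrix (Fin n) (Fin n) ℝ) {m : ℕ} (a : Fin n) (r : Fin m → Fin n)
    (q : Fin (m + 1)) (c : Fin (m + 1) → Fin n) :
    (x.submatrix (Fin.cons a r) c).det =
      (-1) ^ (q : ℕ) * (x.submatrix (q.insertNth a r) c).det := by
  have h : x.submatrix (Fin.cons a r : Fin (m + 1) → Fin n) c =
      (x.submatrix (q.insertNth a r : Fin (m + 1) → Fin n) c).submatrix q.cycleRange.symm id := by
    ext i j
    simp [Fin.insertNth_apply_cycleRange_symm]
  rw [h, det_permute, Equiv.Perm.sign_symm, Fin.sign_cycleRange]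
  simp

theorem det_updateRow_single (A : Matrix (Fin (n + 1)) (Fin (n + 1)) ℝ) (i : Fin (n + 1)) :
    (A.updateRow i (Pi.single 0 1)).det =
      (-1) ^ (i : ℕ) * (A.submatrix i.succAbove Fin.succ).det := by
  rw [det_succ_row _ i, Finset.sum_eq_single 0]
  · simp
  · intro j _ hj
    simp [hj]
  · simp

/-- For an increasing row sequence `r` with `r q = a`, where `a` is followed by a row `b` not
in `r`: insertion of `b` behind `a` in the sequence `r` without its first element is increasing. -/
theorem strictMono_insertNth {m : ℕ} {r : Fin (m + 1) → Fin n} (hr : StrictMono r) {q : Fin m}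
    {b : Fin n} (hb : b.val = (r q.succ).val + 1) (hbr : ∀ i, r i ≠ b) :
    StrictMono (q.castSucc.insertNth (r q.succ) (Function.update (fun i => r i.succ) q b) :
      Fin (m + 1) → Fin n) := by
  have hr' : StrictMono fun i : Fin m => r i.succ := hr.comp (Fin.strictMono_succ)
  have hu : StrictMono (Function.update (fun i => r i.succ) q b) :=
    strictMono_update hr' (fun i => hbr _) (Or.inl hb)
  refine (Fin.strictMono_insertNth_iff _ _ _).2 ⟨hu, fun i hi => ?_, fun i hi => ?_⟩
  · have hi' : i < q := hi
    rw [Function.update_of_ne hi'.ne]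
    exact hr' hi'
  · rcases (show q ≤ i from hi).eq_or_lt with rfl | hi'
    · rw [Function.update_self, Fin.lt_def]
      omega
    · rw [Function.update_of_ne hi'.ne']
      exact hr' hi'

/-- The factor by which a minor grows when its row `r q.succ` is replaced by the following row is at
least the factor for the smaller minor without the first row and column. This is the Plücker
relation for the rows `r 0`, `r q.succ`, `b` and the first unit vector: the term left out of the
inequality is a product of two nonnegative minors. -/
theorem IsTotallyNonnegative.det_mul_det_update_le {x : Matrix (Fin n) (Fin n) ℝ}
    (hx : IsTotallyNonnegative x) {m : ℕ} {r c : Fin (m + 1) → Fin n} (hr : StrictMono r)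
    (hc : StrictMono c) {q : Fin m} {b : Fin n} (hb : b.val = (r q.succ).val + 1)
    (hbr : ∀ i, r i ≠ b) :
    (x.submatrix r c).det *
        (x.submatrix (Function.update (fun i => r i.succ) q b) (fun j => c j.succ)).det ≤
      (x.submatrix (fun i : Fin m => r i.succ) (fun j : Fin m => c j.succ)).det *
        (x.submatrix (Function.update r q.succ b) c).det := by
  have key := det_mul_det_updateRow (x.submatrix r c) (Fin.succ_ne_zero q).symm (Pi.single 0 1)
    (fun j => x b (c j))
  have h1 : (x.submatrix r c).updateRow q.succ (fun j => x b (c j)) =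
      x.submatrix (Function.update r q.succ b) c := by
    ext i j
    by_cases h : i = q.succ
    · subst h
      simp
    · simp [h]
  have h2 : ((x.submatrix r c).updateRow 0 (x.submatrix r c q.succ)).updateRow q.succ
      (fun j => x b (c j)) =
      x.submatrix (Fin.cons (r q.succ) (Function.update (fun i => r i.succ) q b)) c := by
    ext i j
    cases i using Fin.cases with
    | zero => simp [(Fin.succ_ne_zero q).symm]
    | succ i =>
      by_cases h : i = q
      · subst h
        simp
      · simp [h]
  have h3 : (x.submatrix (Function.update r q.succ b) c).submatrix (Fin.succAbove 0) Fin.succ =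
      x.submatrix (Function.update (fun i => r i.succ) q b) (fun j => c j.succ) := by
    ext i j
    by_cases h : i = q
    · subst h
      simp
    · simp [h]
  rw [updateRow_comm _ (Fin.succ_ne_zero q).symm, h1, h2, det_updateRow_single,
    det_updateRow_single, det_updateRow_single, h3, det_submatrix_cons x _ _ q.castSucc] at key
  have h4 : 0 ≤ ((x.submatrix r c).submatrix q.succ.succAbove Fin.succ).det :=
    hx.det_nonneg (hr.comp (Fin.strictMono_succAbove _)) (hc.comp Fin.strictMono_succ)
  have h5 := hx.det_nonneg (strictMono_insertNth hr hb hbr) hc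
  have h6 : ((-1 : ℝ) ^ (q.succ : ℕ)) * (-1) ^ (q.castSucc : ℕ) = -1 := by
    rw [← pow_add]
    exact Odd.neg_one_pow ⟨q, by simp; ring⟩
  have h7 : (x.submatrix r c).submatrix (Fin.succAbove 0) Fin.succ =
      x.submatrix (fun i => r i.succ) (fun j => c j.succ) := by
    ext i j
    simp
  rw [h7, Fin.val_zero, pow_zero, one_mul, one_mul, mul_mul_mul_comm, h6] at key
  have := mul_nonneg h4 h5
  linarith

/-! ### Neville elimination -/

/-- If replacing the row `a` by its successor `b` multiplies by at least `ρ` all minors whose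
first row is `a`, then it does so for all minors containing `a` and not `b`. -/
theorem IsTotallyNonnegative.mul_det_le_det_update {x : Matrix (Fin n) (Fin n) ℝ}
    (hx : IsTotallyNonnegative x) {a b : Fin n} (hb : b.val = a.val + 1) {ρ : ℝ}
    (hfirst : ∀ (m : ℕ) (r c : Fin (m + 1) → Fin n), StrictMono r → StrictMono c → r 0 = a →
      (∀ i, r i ≠ b) →
      ρ * (x.submatrix r c).det ≤ (x.submatrix (Function.update r 0 b) c).det)
    {m : ℕ} {r c : Fin m → Fin n} (hr : StrictMono r) (hc : StrictMono c) {q : Fin m}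
    (hq : r q = a) (hbr : ∀ i, r i ≠ b) :
    ρ * (x.submatrix r c).det ≤ (x.submatrix (Function.update r q b) c).det := by
  induction m with
  | zero => exact q.elim0
  | succ m ih =>
    cases q using Fin.cases with
    | zero => exact hfirst m r c hr hc hq hbr
    | succ q =>
      rcases (hx.det_nonneg hr hc).eq_or_lt with h0 | hD
      · rw [← h0, mul_zero]
        exact hx.det_nonneg (strictMono_update hr hbr (Or.inl (by rw [hq, hb]))) hc
      · have hK := (hx.submatrix hr hc).det_succ_pos hD.ne'
        have hK' : 0 < (x.submatrix (fun i : Fin m => r i.succ) (fun j : Fin m => c j.succ)).det := hK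
        have h1 := ih (r := fun i => r i.succ) (c := fun j => c j.succ)
          (hr.comp Fin.strictMono_succ) (hc.comp Fin.strictMono_succ) hq (fun i => hbr _)
        have h2 := hx.det_mul_det_update_le hr hc (q := q) (by rw [hq, hb]) hbr
        refine le_of_mul_le_mul_left ?_ hK'
        calc _ = (x.submatrix r c).det *
              (ρ * (x.submatrix (fun i : Fin m => r i.succ) (fun j : Fin m => c j.succ)).det) := by ring
          _ ≤ _ := mul_le_mul_of_nonneg_left h1 hD.le
          _ ≤ _ := h2

/-- Under the hypothesis of `IsTotallyNonnegative.mul_det_le_det_update`, subtraction of `ρ` times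
row `a` from row `b` preserves total nonnegativity. -/
theorem IsTotallyNonnegative.sub_row {x : Matrix (Fin n) (Fin n) ℝ}
    (hx : IsTotallyNonnegative x) {a b : Fin n} (hb : b.val = a.val + 1) {ρ : ℝ}
    (hfirst : ∀ (m : ℕ) (r c : Fin (m + 1) → Fin n), StrictMono r → StrictMono c → r 0 = a →
      (∀ i, r i ≠ b) →
      ρ * (x.submatrix r c).det ≤ (x.submatrix (Function.update r 0 b) c).det) :
    IsTotallyNonnegative ((1 + single b a (-ρ)) * x) := by
  refine isTotallyNonnegative_of_strictMono fun k f g hf hg => ?_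
  by_cases h : ∃ m, f m = b
  · obtain ⟨m, hm⟩ := h
    rw [det_submatrix_transvection_mul _ _ _ _ hf.injective hm]
    by_cases ha : ∃ m', f m' = a
    · obtain ⟨m', rfl⟩ := ha
      rw [det_submatrix_update_of_mem, mul_zero, add_zero]
      · exact hx.det_nonneg hf hg
      · rintro rfl
        rw [hm] at hb
        omega
    · push Not at ha
      have hmono := strictMono_update hf ha (m := m) (Or.inr (by rw [hm, hb]))
      have := hx.mul_det_le_det_update hb hfirst hmono hg (q := m) (by simp) (fun i => by
        by_cases hi : i = m
        · subst hi
          rw [Function.update_self, Ne, Fin.ext_iff]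
          omega
        · rw [Function.update_of_ne hi, ← hm]
          exact hf.injective.ne hi)
      rw [Function.update_idem, ← hm, Function.update_eq_self] at this
      linarith
  · push Not at h
    rw [det_submatrix_transvection_mul_of_notMem _ _ _ _ h]
    exact hx.det_nonneg hf hg

/-- The hypothesis of `IsTotallyNonnegative.mul_det_le_det_update` holds for the pivot quotient of a
column `j` that vanishes below row `b`, if all columns before `j` vanish from row `a` on. The
difference of the two sides is, up to the factor `x a j`, the minor with row `a` and column `j`
added in front, expanded along this column. -/
theorem IsTotallyNonnegative.pivot_mul_det_le {x : Matrix (Fin n) (Fin n) ℝ}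
    (hx : IsTotallyNonnegative x) {a b j : Fin n} (hb : b.val = a.val + 1) (ha : 0 < x a j)
    (hcol : ∀ i, b < i → x i j = 0) (hleft : ∀ i k, a ≤ i → k < j → x i k = 0) {m : ℕ}
    {r c : Fin (m + 1) → Fin n} (hr : StrictMono r) (hc : StrictMono c) (hr0 : r 0 = a)
    (hbr : ∀ i, r i ≠ b) :
    x b j / x a j * (x.submatrix r c).det ≤ (x.submatrix (Function.update r 0 b) c).det := by
  have hab : a < b := by rw [Fin.lt_def]; omega
  set r' := Function.update r 0 b with hr'
  have hr'mono : StrictMono r' := strictMono_update hr hbr (Or.inl (by rw [hr0, hb]))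
  have hr'b : ∀ i, b ≤ r' i := fun i => by
    have := hr'mono.monotone (Fin.zero_le i)
    rwa [hr', Function.update_self] at this
  have hmono : StrictMono (Fin.cons a r' : Fin (m + 2) → Fin n) :=
    Fin.strictMono_cons.2 ⟨fun i => hab.trans_le (hr'b i), hr'mono⟩
  set W := x.submatrix (Fin.cons a r' : Fin (m + 2) → Fin n) (Fin.cons j c : Fin (m + 2) → Fin n)
    with hW
  have hexp : W.det = x a j * (x.submatrix r' c).det - x b j * (x.submatrix r c).det := by
    rw [det_succ_column_zero, Fin.sum_univ_succ, Fin.sum_univ_succ, Finset.sum_eq_zero]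
    · have h1 : W.submatrix (Fin.succAbove 0) Fin.succ = x.submatrix r' c := by
        ext i k
        simp [hW]
      have h2 : W.submatrix (Fin.succAbove (Fin.succ 0)) Fin.succ = x.submatrix r c := by
        ext i k
        cases i using Fin.cases with
        | zero => simp [hW, hr0]
        | succ i =>
          have : r' i.succ = r i.succ := by simp [hr']
          simp [hW, this]
      rw [h1, h2]
      simp [hW, hr']
      ring
    · intro i _
      have : W i.succ.succ 0 = 0 := by
        have hlt : b < r' i.succ := by
          have := hr'mono (Fin.succ_pos i)
          rwa [hr', Function.update_self] at this
        simpa [hW] using hcol _ hlt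
      rw [this]
      ring
  have hnonneg : 0 ≤ W.det := by
    rcases lt_trichotomy (c 0) j with h | h | h
    · refine (det_eq_zero_of_column_eq_zero (Fin.succ 0) fun i => ?_).ge
      have : a ≤ (Fin.cons a r' : Fin (m + 2) → Fin n) i := by
        have := hmono.monotone (Fin.zero_le i)
        simpa using this
      simpa [hW] using hleft _ _ this h
    · refine (det_zero_of_column_eq (Fin.succ_ne_zero 0) fun i => ?_).ge
      simp [hW, h]
    · refine hx.det_nonneg hmono (Fin.strictMono_cons.2 ⟨fun i => ?_, hc⟩)
      exact h.trans_le (hc.monotone (Fin.zero_le i))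
  rw [hexp] at hnonneg
  rw [div_mul_eq_mul_div, div_le_iff₀ ha]
  linarith

/-! ### Factorization of invertible totally nonnegative matrices -/

theorem one_add_single_mul_one_sub_single {a b : Fin n} (hab : a ≠ b) (t : ℝ) :
    (1 + single b a t) * (1 + single b a (-t)) = (1 : Matrix (Fin n) (Fin n) ℝ) := by
  rw [transvection_mul_eq_updateRow]
  ext i k
  by_cases h : i = b
  · subst h
    rw [updateRow_self]
    simp [Matrix.add_apply, single_apply, one_apply, hab.symm]
    split_ifs <;> ring
  · rw [updateRow_ne h]
    simp [Ne.symm h]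

/-- One step of Neville elimination: an invertible totally nonnegative matrix with a nonzero entry
below the diagonal is the product of some `1 + ρ E_{a+1,a}`, `ρ > 0`, and a totally nonnegative
matrix with fewer nonzero entries. The step clears the lowest nonzero entry of the first column
that is not zero below the diagonal. -/
theorem IsTotallyNonnegative.exists_elimination {x : Matrix (Fin n) (Fin n) ℝ}
    (hx : IsTotallyNonnegative x) (hdet : x.det ≠ 0) (hlow : ∃ i j, j < i ∧ x i j ≠ 0) :
    ∃ (i : Fin (n - 1)) (ρ : ℝ) (y : Matrix (Fin n) (Fin n) ℝ), 0 < ρ ∧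
      IsTotallyNonnegative y ∧ x = elementaryJacobi (.barred i) ρ * y ∧
      (Finset.univ.filter fun p : Fin n × Fin n => y p.1 p.2 ≠ 0).card <
        (Finset.univ.filter fun p : Fin n × Fin n => x p.1 p.2 ≠ 0).card := by
  obtain ⟨i₀, j₀, hij₀, hx₀⟩ := hlow
  obtain ⟨j, ⟨i₁, hi₁, hx₁⟩, hjmin⟩ := Set.exists_min_image
    {j : Fin n | ∃ i, j < i ∧ x i j ≠ 0} id (Set.toFinite _) ⟨j₀, i₀, hij₀, hx₀⟩
  obtain ⟨b, hbj, hbmax⟩ := Set.exists_max_image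
    {i : Fin n | x i j ≠ 0} id (Set.toFinite _) ⟨i₁, hx₁⟩
  have hjb : j < b := hi₁.trans_le (hbmax i₁ hx₁)
  have hb0 : 0 < b.val := by omega
  let i : Fin (n - 1) := ⟨b.val - 1, by omega⟩
  let a : Fin n := ⟨b.val - 1, by omega⟩
  have hb : b.val = a.val + 1 := by simp only [a]; omega
  have hab : a < b := by rw [Fin.lt_def]; omega
  have hja : j ≤ a := by rw [Fin.le_def]; omega
  have hcol : ∀ i, b < i → x i j = 0 := fun i hi => by
    by_contra h
    exact absurd (hbmax i h) (not_le.2 hi)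
  have hleft : ∀ i k, a ≤ i → k < j → x i k = 0 := fun i k hi hk => by
    by_contra h
    exact absurd (hjmin k ⟨i, hk.trans_le (hja.trans hi), h⟩) (not_le.2 hk)
  have hxb : 0 < x b j := lt_of_le_of_ne (hx.apply_nonneg _ _) (Ne.symm hbj)
  -- a zero pivot would force the whole row `a` to vanish
  have hxa : 0 < x a j := by
    refine lt_of_le_of_ne (hx.apply_nonneg _ _) fun h => hdet ?_
    refine det_eq_zero_of_row_eq_zero a fun k => ?_
    rcases lt_trichotomy k j with hk | rfl | hk
    · exact hleft a k le_rfl hk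
    · exact h.symm
    · have h1 := hx.mul_le_mul hab hk
      rw [← h, zero_mul] at h1
      exact le_antisymm (nonpos_of_mul_nonpos_left h1 hxb) (hx.apply_nonneg _ _)
  set ρ := x b j / x a j with hρ
  have hρ0 : 0 < ρ := div_pos hxb hxa
  have hy : IsTotallyNonnegative ((1 + single b a (-ρ)) * x) :=
    hx.sub_row hb fun m r c hr hc hr0 hbr => hx.pivot_mul_det_le hb hxa hcol hleft hr hc hr0 hbr
  have hletter : elementaryJacobi (.barred i) ρ = 1 + single b a ρ := by
    have : (⟨i.val + 1, by omega⟩ : Fin n) = b := Fin.ext (by simp only [i]; omega)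
    change 1 + single (⟨i.val + 1, by omega⟩ : Fin n) (⟨i.val, by omega⟩ : Fin n) ρ = _
    rw [this]
  refine ⟨i, ρ, _, hρ0, hy, ?_, ?_⟩
  · rw [hletter, ← Matrix.mul_assoc, one_add_single_mul_one_sub_single hab.ne, Matrix.one_mul]
  · have hyb : ∀ k, ((1 + single b a (-ρ)) * x) b k = x b k - ρ * x a k := fun k => by
      rw [transvection_mul_eq_updateRow, updateRow_self]
      simp [sub_eq_add_neg]
    have hyne : ∀ l k, l ≠ b → ((1 + single b a (-ρ)) * x) l k = x l k := fun l k hl => by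
      rw [transvection_mul_eq_updateRow, updateRow_ne hl]
    refine Finset.card_lt_card (Finset.ssubset_iff_of_subset ?_ |>.2 ⟨(b, j), ?_, ?_⟩)
    · rintro ⟨l, k⟩ hlk
      simp only [Finset.mem_filter, Finset.mem_univ, true_and] at hlk ⊢
      by_cases hl : l = b
      · subst hl
        -- a zero of `x` in row `b` stays a zero, since the new entry is nonnegative
        intro h
        apply hlk
        refine le_antisymm ?_ (hy.apply_nonneg _ _)
        rw [hyb, h, zero_sub]
        exact neg_nonpos.2 (mul_nonneg hρ0.le (hx.apply_nonneg _ _))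
      · rwa [hyne l k hl] at hlk
    · simpa using hbj
    · simp only [Finset.mem_filter, Finset.mem_univ, true_and, not_not]
      rw [hyb, hρ]
      field_simp
      ring

/-- The matrix is a product of elementary Jacobi matrices with positive parameters. -/
def IsJacobiProduct (A : Matrix (Fin n) (Fin n) ℝ) : Prop :=
  ∃ L : List (Letter n × ℝ), (∀ p ∈ L, 0 < p.2) ∧ A = jacobiProd L

theorem isJacobiProduct_one : IsJacobiProduct (1 : Matrix (Fin n) (Fin n) ℝ) :=
  ⟨[], by simp, rfl⟩

theorem IsJacobiProduct.elementaryJacobi_mul {A : Matrix (Fin n) (Fin n) ℝ}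
    (hA : IsJacobiProduct A) (a : Letter n) {t : ℝ} (ht : 0 < t) :
    IsJacobiProduct (elementaryJacobi a t * A) := by
  obtain ⟨L, hL, rfl⟩ := hA
  exact ⟨(a, t) :: L, by simpa [ht] using hL, by simp⟩

/-- The letter whose elementary Jacobi matrix is the transpose. -/
def Letter.transpose : Letter n → Letter n
  | .plain i => .barred i
  | .circled i => .circled i
  | .barred i => .plain i

theorem transpose_elementaryJacobi (a : Letter n) (t : ℝ) :
    (elementaryJacobi a t)ᵀ = elementaryJacobi a.transpose t := by
  cases a <;> simp [elementaryJacobi, Letter.transpose, transpose_add]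

theorem IsJacobiProduct.transpose {A : Matrix (Fin n) (Fin n) ℝ} (hA : IsJacobiProduct A) :
    IsJacobiProduct Aᵀ := by
  obtain ⟨L, hL, rfl⟩ := hA
  refine ⟨(L.map fun p => (p.1.transpose, p.2)).reverse, ?_, ?_⟩
  · intro p hp
    obtain ⟨q, hq, rfl⟩ : ∃ q ∈ L, (q.1.transpose, q.2) = p := by simpa using hp
    exact hL q hq
  · rw [jacobiProd, transpose_list_prod, jacobiProd, List.map_reverse, List.map_map, List.map_map]
    congr 2
    exact List.map_congr_left fun p _ => transpose_elementaryJacobi p.1 p.2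

theorem isJacobiProduct_diagonal {d : Fin n → ℝ} (hd : ∀ i, 0 < d i) :
    IsJacobiProduct (diagonal d) := by
  have key : ∀ s : Finset (Fin n), IsJacobiProduct (diagonal fun i => if i ∈ s then d i else 1) := by
    intro s
    induction s using Finset.induction_on with
    | empty => simpa using isJacobiProduct_one
    | insert j s hj ih =>
      convert ih.elementaryJacobi_mul (.circled j) (hd j) using 1
      change _ = (1 + single j j (d j - 1)) * _
      rw [transvection_mul_eq_updateRow]
      ext i k
      by_cases hi : i = j
      · subst hi
        by_cases hk : i = k
        · subst hk
          simp [hj]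
        · simp [hk]
      · rw [updateRow_ne hi]
        simp [diagonal_apply, hi]
  simpa using key Finset.univ

/-- The Loewner–Whitney theorem: an invertible totally nonnegative matrix is a product of elementary
Jacobi matrices with positive parameters. -/
theorem IsTotallyNonnegative.isJacobiProduct {x : Matrix (Fin n) (Fin n) ℝ}
    (hx : IsTotallyNonnegative x) (hdet : x.det ≠ 0) : IsJacobiProduct x := by
  induction hN : (Finset.univ.filter fun p : Fin n × Fin n => x p.1 p.2 ≠ 0).card
    using Nat.strong_induction_on generalizing x with
  | _ N ih =>
    by_cases hlow : ∃ i j, j < i ∧ x i j ≠ 0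
    · obtain ⟨i, ρ, y, hρ, hy, rfl, hlt⟩ := hx.exists_elimination hdet hlow
      rw [det_mul] at hdet
      exact (ih _ (hN ▸ hlt) hy (right_ne_zero_of_mul hdet) rfl).elementaryJacobi_mul _ hρ
    by_cases hup : ∃ i j, i < j ∧ x i j ≠ 0
    · obtain ⟨j, i, hij, hne⟩ := hup
      obtain ⟨i, ρ, y, hρ, hy, hxy, hlt⟩ :=
        hx.transpose.exists_elimination (by rwa [det_transpose]) ⟨i, j, hij, hne⟩
      have hcard : (Finset.univ.filter fun p : Fin n × Fin n => xᵀ p.1 p.2 ≠ 0).card = N := by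
        rw [← hN]
        exact Finset.card_equiv (Equiv.prodComm _ _) fun p => by
          rw [Finset.mem_filter, Finset.mem_filter]
          simp
      have hydet : y.det ≠ 0 := fun h => hdet <| by
        rw [← det_transpose, hxy, det_mul, h, mul_zero]
      have := (ih _ (hcard ▸ hlt) hy hydet rfl).elementaryJacobi_mul (.barred i) hρ
      rw [← hxy] at this
      simpa using this.transpose
    · push Not at hlow hup
      have hdiag : x = diagonal fun i => x i i := by
        ext i j
        rcases lt_trichotomy i j with h | rfl | h
        · rw [hup i j h, diagonal_apply_ne _ h.ne]
        · simp
        · rw [hlow i j h, diagonal_apply_ne _ h.ne']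
      rw [hdiag]
      refine isJacobiProduct_diagonal fun i => lt_of_le_of_ne (hx.apply_nonneg i i) fun h => hdet ?_
      rw [hdiag, det_diagonal]
      exact Finset.prod_eq_zero (Finset.mem_univ i) h.symm

/-! ### Block-triangular matrices -/

theorem blockTriangular_le_iff {R : Type*} [Zero R] {i : ℕ} {A : Matrix (Fin n) (Fin n) R} :
    A.BlockTriangular (fun k : Fin n => (i ≤ k.val : Prop)) ↔
      ∀ h j : Fin n, h.val < i → i ≤ j.val → A j h = 0 := by
  constructor
  · intro h p q hp hq
    exact h ⟨fun h' => absurd h' (not_le.2 hp), fun h' => absurd (h' hq) (not_le.2 hp)⟩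
  · intro h p q hpq
    obtain ⟨h1, h2⟩ := Classical.not_imp.1 hpq.2
    exact h q p (not_le.1 h2) h1

theorem blockTriangular_lt_iff {R : Type*} [Zero R] {i : ℕ} {A : Matrix (Fin n) (Fin n) R} :
    A.BlockTriangular (fun k : Fin n => (k.val < i : Prop)) ↔
      ∀ h j : Fin n, h.val < i → i ≤ j.val → A h j = 0 := by
  constructor
  · intro h p q hp hq
    exact h ⟨fun h' => absurd h' (not_lt.2 hq), fun h' => absurd (h' hp) (not_lt.2 hq)⟩
  · intro h p q hpq
    obtain ⟨h1, h2⟩ := Classical.not_imp.1 hpq.2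
    exact h p q h1 (not_lt.1 h2)

theorem blockTriangular_jacobiProd {α : Type*} [LinearOrder α] {b : Fin n → α}
    {L : List (Letter n × ℝ)} (hL : ∀ p ∈ L, (elementaryJacobi p.1 p.2).BlockTriangular b) :
    (jacobiProd L).BlockTriangular b := by
  induction L with
  | nil => exact blockTriangular_one
  | cons p L ih =>
    rw [jacobiProd_cons]
    exact (hL p List.mem_cons_self).mul (ih fun q hq => hL q (List.mem_cons_of_mem _ hq))

/-- A word without some plain or some barred letter gives a block-triangular matrix. -/
theorem isBlockTriangular_jacobiProd {L : List (Letter n × ℝ)} (hL : ¬ HasFullSupport L) :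
    IsBlockTriangular (jacobiProd L) := by
  obtain ⟨i, hi⟩ := not_forall.1 hL
  refine ⟨i.val + 1, by omega, by omega, ?_⟩
  rcases not_and_or.1 hi with hi | hi
  · left
    refine blockTriangular_lt_iff.1 (blockTriangular_jacobiProd fun p hp => ?_)
    refine blockTriangular_lt_iff.2 fun h j hh hj => ?_
    have hne : p.1 ≠ .plain i := fun h' => hi ⟨p, hp, h'⟩
    have hhj : h ≠ j := by omega
    rcases p with ⟨a, t⟩
    cases a with
    | plain k =>
      have hk : k.val ≠ i.val := fun h' => hne (by rw [Fin.ext h'])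
      simp only [elementaryJacobi, Matrix.add_apply, one_apply_ne hhj, zero_add]
      exact single_apply_of_ne _ _ _ _ _ (by simp only [Fin.ext_iff]; omega)
    | circled k =>
      simp only [elementaryJacobi, Matrix.add_apply, one_apply_ne hhj, zero_add]
      exact single_apply_of_ne _ _ _ _ _ (by simp only [Fin.ext_iff]; omega)
    | barred k =>
      simp only [elementaryJacobi, Matrix.add_apply, one_apply_ne hhj, zero_add]
      exact single_apply_of_ne _ _ _ _ _ (by simp only [Fin.ext_iff]; omega)
  · right
    refine blockTriangular_le_iff.1 (blockTriangular_jacobiProd fun p hp => ?_)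
    refine blockTriangular_le_iff.2 fun h j hh hj => ?_
    have hne : p.1 ≠ .barred i := fun h' => hi ⟨p, hp, h'⟩
    have hhj : j ≠ h := by omega
    rcases p with ⟨a, t⟩
    cases a with
    | plain k =>
      simp only [elementaryJacobi, Matrix.add_apply, one_apply_ne hhj, zero_add]
      exact single_apply_of_ne _ _ _ _ _ (by simp only [Fin.ext_iff]; omega)
    | circled k =>
      simp only [elementaryJacobi, Matrix.add_apply, one_apply_ne hhj, zero_add]
      exact single_apply_of_ne _ _ _ _ _ (by simp only [Fin.ext_iff]; omega)
    | barred k =>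
      have hk : k.val ≠ i.val := fun h' => hne (by rw [Fin.ext h'])
      simp only [elementaryJacobi, Matrix.add_apply, one_apply_ne hhj, zero_add]
      exact single_apply_of_ne _ _ _ _ _ (by simp only [Fin.ext_iff]; omega)

/-- Powers of a block-triangular matrix are block-triangular, so they have a zero entry. -/
theorem IsBlockTriangular.not_isTotallyPositive_pow {A : Matrix (Fin n) (Fin n) ℝ}
    (hA : IsBlockTriangular A) (m : ℕ) : ¬ IsTotallyPositive (A ^ m) := by
  have hpow : ∀ {α : Type} [LinearOrder α] {b : Fin n → α}, A.BlockTriangular b →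
      (A ^ m).BlockTriangular b := by
    intro α _ b h
    induction m with
    | zero => exact blockTriangular_one
    | succ m ih => exact (pow_succ A m).symm ▸ ih.mul h
  intro hpos
  have hentry : ∀ p q : Fin n, 0 < (A ^ m) p q := fun p q => by
    have := hpos 1 (OrderEmbedding.ofStrictMono (fun _ => p) (Subsingleton.strictMono _))
      (OrderEmbedding.ofStrictMono (fun _ => q) (Subsingleton.strictMono _))
    simpa using this
  obtain ⟨i, hi, hin, h | h⟩ := hA
  · exact (hentry _ _).ne' (blockTriangular_lt_iff.1 (hpow (blockTriangular_lt_iff.2 h))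
      ⟨0, by omega⟩ ⟨i, hin⟩ hi le_rfl)
  · exact (hentry _ _).ne' (blockTriangular_le_iff.1 (hpow (blockTriangular_le_iff.2 h))
      ⟨0, by omega⟩ ⟨i, hin⟩ hi le_rfl)

/-! ### Bruhat decomposition -/

theorem permGL_apply (w : Equiv.Perm (Fin n)) (i j : Fin n) :
    (permGL w : Matrix (Fin n) (Fin n) ℂ) i j = if i = w j then 1 else 0 := by
  change (Equiv.Perm.permMatrix ℂ w⁻¹) i j = _
  simp [Equiv.Perm.permMatrix, PEquiv.toMatrix_apply, Equiv.symm_apply_eq]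

theorem exists_mem_upperBorel {A : Matrix (Fin n) (Fin n) ℂ} (hA : A.IsUpperTriangular)
    (hd : ∀ i, A i i ≠ 0) : ∃ b ∈ upperBorel n, (b : Matrix (Fin n) (Fin n) ℂ) = A := by
  have hdet : A.det ≠ 0 := by
    rw [det_of_isUpperTriangular hA]
    exact Finset.prod_ne_zero_iff.2 fun i _ => hd i
  exact ⟨GeneralLinearGroup.mkOfDetNeZero A hdet, hA, rfl⟩

/-- The first `k` columns have exactly one nonzero entry each, and this entry is also the only one
in its row. -/
def IsMonomialUpTo (k : ℕ) (y : Matrix (Fin n) (Fin n) ℂ) : Prop :=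
  ∀ j : Fin n, j.val < k → ∃ r, y r j ≠ 0 ∧ (∀ p, p ≠ r → y p j = 0) ∧ ∀ q, q ≠ j → y r q = 0

/-- One step of Gaussian elimination with upper triangular row and column operations: the pivot is
the lowest nonzero entry of column `k`. -/
theorem exists_isMonomialUpTo_succ (y : GL (Fin n) ℂ) {k : ℕ} (hk : k < n)
    (hy : IsMonomialUpTo k (y : Matrix (Fin n) (Fin n) ℂ)) :
    ∃ b ∈ upperBorel n, ∃ b' ∈ upperBorel n,
      IsMonomialUpTo (k + 1) ((b * y * b' : GL (Fin n) ℂ) : Matrix (Fin n) (Fin n) ℂ) := by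
  set Y := (y : Matrix (Fin n) (Fin n) ℂ) with hY
  let κ : Fin n := ⟨k, hk⟩
  have hcol : ∃ r, Y r κ ≠ 0 := by
    by_contra! h
    have hdet : Y.det ≠ 0 := ((isUnit_iff_isUnit_det _).1 y.isUnit).ne_zero
    exact hdet (det_eq_zero_of_column_eq_zero κ h)
  obtain ⟨r, hr, hmax⟩ := Set.exists_max_image {r : Fin n | Y r κ ≠ 0} id (Set.toFinite _) hcol
  have hr : Y r κ ≠ 0 := hr
  have hbelow : ∀ p, r < p → Y p κ = 0 := fun p hp => by
    by_contra h
    exact absurd (hmax p h) (not_le.2 hp)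
  have hleft : ∀ j : Fin n, j.val < k → Y r j = 0 := fun j hj => by
    obtain ⟨s, -, hs, hs'⟩ := hy j hj
    refine hs r ?_
    rintro rfl
    exact hr (hs' κ (by rintro rfl; exact lt_irrefl _ hj))
  let c : Fin n → ℂ := fun p => if p = r then 0 else Y p κ / Y r κ
  let d : Fin n → ℂ := fun q => if q = κ then 0 else Y r q / Y r κ
  have hcr : c r = 0 := by simp [c]
  have hdκ : d κ = 0 := by simp [d]
  have hc : ∀ p, p ≠ r → c p = Y p κ / Y r κ := fun p hp => by simp [c, hp]
  have hd : ∀ q, q ≠ κ → d q = Y r q / Y r κ := fun q hq => by simp [d, hq]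
  obtain ⟨b, hb, hbA⟩ := exists_mem_upperBorel (A := 1 - vecMulVec c (Pi.single r 1))
    (fun p q hqp => by
      have hqp : q < p := hqp
      by_cases h : q = r
      · subst h
        simp [vecMulVec_apply, one_apply_ne hqp.ne', hc p hqp.ne', hbelow p hqp]
      · simp [vecMulVec_apply, one_apply_ne hqp.ne', h])
    (fun i => by
      by_cases h : i = r
      · subst h
        simp [vecMulVec_apply, hcr]
      · simp [vecMulVec_apply, h])
  obtain ⟨b', hb', hbA'⟩ := exists_mem_upperBorel (A := 1 - vecMulVec (Pi.single κ 1) d)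
    (fun p q hqp => by
      have hqp : q < p := hqp
      by_cases h : p = κ
      · subst h
        simp [vecMulVec_apply, one_apply_ne hqp.ne', hd q hqp.ne, hleft q hqp]
      · simp [vecMulVec_apply, one_apply_ne hqp.ne', h])
    (fun i => by
      by_cases h : i = κ
      · subst h
        simp [vecMulVec_apply, hdκ]
      · simp [vecMulVec_apply, h])
  have hform : ∀ p q, ((b * y * b' : GL (Fin n) ℂ) : Matrix (Fin n) (Fin n) ℂ) p q =
      (Y p q - c p * Y r q) - (Y p κ - c p * Y r κ) * d q := fun p q => by
    have h1 : (1 - vecMulVec c (Pi.single r 1)) * Y = Y - vecMulVec c (Y r) := by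
      rw [Matrix.sub_mul, Matrix.one_mul, vecMulVec_mul, single_one_vecMul]
      rfl
    rw [Units.val_mul, Units.val_mul, hbA, hbA', ← hY, h1, Matrix.mul_sub, Matrix.mul_one,
      mul_vecMulVec, mulVec_single_one]
    simp [vecMulVec_apply]
  have hrow : ∀ q, q ≠ κ → ((b * y * b' : GL (Fin n) ℂ) : Matrix (Fin n) (Fin n) ℂ) r q = 0 :=
    fun q hq => by
      rw [hform, hcr, hd q hq]
      field_simp
      ring
  have hother : ∀ p q, p ≠ r → ((b * y * b' : GL (Fin n) ℂ) : Matrix (Fin n) (Fin n) ℂ) p q =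
      Y p q - c p * Y r q := fun p q hp => by
    rw [hform, hc p hp]
    field_simp
    ring
  refine ⟨b, hb, b', hb', fun j hj => ?_⟩
  rcases Nat.lt_succ_iff_lt_or_eq.1 hj with hj | hj
  · obtain ⟨s, hs, hs1, hs2⟩ := hy j hj
    have hjκ : κ ≠ j := by rintro rfl; exact lt_irrefl _ hj
    have hsr : s ≠ r := by rintro rfl; exact hr (hs2 κ hjκ)
    have hcs : c s = 0 := by rw [hc s hsr, hs2 κ hjκ, zero_div]
    refine ⟨s, ?_, fun p hp => ?_, fun q hq => ?_⟩
    · rw [hother s j hsr, hcs, zero_mul, sub_zero]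
      exact hs
    · by_cases hpr : p = r
      · rw [hpr, hrow j hjκ.symm]
      · rw [hother p j hpr, hs1 p hp, hleft j hj, mul_zero, sub_zero]
    · rw [hother s q hsr, hcs, hs2 q hq, zero_mul, sub_zero]
  · obtain rfl : j = κ := Fin.ext hj
    refine ⟨r, ?_, fun p hp => ?_, hrow⟩
    · rw [hform, hcr, hdκ]
      simpa using hr
    · rw [hother p _ hp, hc p hp]
      field_simp
      ring

/-- The Bruhat decomposition: `GL_n(ℂ)` is the union of the double cosets `B u B`. -/
theorem exists_mem_doubleCoset_upperBorel (g : GL (Fin n) ℂ) : ∃ u : Equiv.Perm (Fin n),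
    g ∈ DoubleCoset.doubleCoset (permGL u) (upperBorel n : Set (GL (Fin n) ℂ)) (upperBorel n) := by
  have key : ∀ k ≤ n, ∃ b ∈ upperBorel n, ∃ b' ∈ upperBorel n,
      IsMonomialUpTo k ((b * g * b' : GL (Fin n) ℂ) : Matrix (Fin n) (Fin n) ℂ) := by
    intro k
    induction k with
    | zero => exact fun _ => ⟨1, one_mem _, 1, one_mem _, fun j hj => absurd hj (Nat.not_lt_zero _)⟩
    | succ k ih =>
      intro hk
      obtain ⟨b, hb, b', hb', h⟩ := ih (by omega)
      obtain ⟨a, ha, a', ha', h'⟩ := exists_isMonomialUpTo_succ _ (by omega) h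
      refine ⟨a * b, mul_mem ha hb, b' * a', mul_mem hb' ha', ?_⟩
      simpa only [mul_assoc] using h'
  obtain ⟨b, hb, b', hb', h⟩ := key n le_rfl
  choose r hr hr1 hr2 using fun j : Fin n => h j j.2
  set y := b * g * b' with hy
  have hinj : Function.Injective r := fun j j' hjj => by
    by_contra hne
    exact hr j' (hjj ▸ hr2 j j' (Ne.symm hne))
  let u : Equiv.Perm (Fin n) := Equiv.ofBijective r (Finite.injective_iff_bijective.1 hinj)
  obtain ⟨t, ht, htd⟩ := exists_mem_upperBorel
    (A := diagonal fun j => (y : Matrix (Fin n) (Fin n) ℂ) (r j) j)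
    (blockTriangular_diagonal _) (fun i => by simpa using hr i)
  have hyt : y = permGL u * t := Units.ext <| by
    rw [Units.val_mul (permGL u), htd]
    ext p j
    rw [mul_diagonal, permGL_apply]
    change _ = (if p = r j then 1 else 0) * _
    split_ifs with hp
    · rw [hp, one_mul]
    · rw [hr1 j p hp, zero_mul]
  refine ⟨u, DoubleCoset.mem_doubleCoset.2 ⟨b⁻¹, inv_mem hb, t * b'⁻¹, mul_mem ht (inv_mem hb'), ?_⟩⟩
  rw [mul_assoc, ← mul_assoc (permGL u), ← hyt, hy]
  group

/-- The transpose as an element of the general linear group. -/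
def transposeGL (g : GL (Fin n) ℂ) : GL (Fin n) ℂ where
  val := (g : Matrix (Fin n) (Fin n) ℂ)ᵀ
  inv := ((g⁻¹ : GL (Fin n) ℂ) : Matrix (Fin n) (Fin n) ℂ)ᵀ
  val_inv := by rw [← transpose_mul, ← Units.val_mul, inv_mul_cancel, Units.val_one, transpose_one]
  inv_val := by rw [← transpose_mul, ← Units.val_mul, mul_inv_cancel, Units.val_one, transpose_one]

theorem transposeGL_mul (g h : GL (Fin n) ℂ) :
    transposeGL (g * h) = transposeGL h * transposeGL g :=
  Units.ext (transpose_mul _ _)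

theorem transposeGL_permGL (w : Equiv.Perm (Fin n)) : transposeGL (permGL w) = permGL w⁻¹ :=
  Units.ext <| by
    ext i j
    change (permGL w : Matrix (Fin n) (Fin n) ℂ) j i = _
    rw [permGL_apply, permGL_apply]
    simp only [Equiv.Perm.eq_inv_iff_eq, eq_comm]

theorem transposeGL_mem_lowerBorel {b : GL (Fin n) ℂ} (hb : b ∈ upperBorel n) :
    transposeGL b ∈ lowerBorel n :=
  BlockTriangular.transpose hb

theorem exists_mem_doubleCoset_lowerBorel (g : GL (Fin n) ℂ) : ∃ v : Equiv.Perm (Fin n),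
    g ∈ DoubleCoset.doubleCoset (permGL v) (lowerBorel n : Set (GL (Fin n) ℂ)) (lowerBorel n) := by
  obtain ⟨u, hu⟩ := exists_mem_doubleCoset_upperBorel (transposeGL g)
  obtain ⟨b, hb, b', hb', h⟩ := DoubleCoset.mem_doubleCoset.1 hu
  refine ⟨u⁻¹, DoubleCoset.mem_doubleCoset.2 ⟨transposeGL b', transposeGL_mem_lowerBorel hb',
    transposeGL b, transposeGL_mem_lowerBorel hb, ?_⟩⟩
  have hg : g = transposeGL (transposeGL g) := rfl
  rw [hg, h, transposeGL_mul, transposeGL_mul, transposeGL_permGL, mul_assoc]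

/-! ### Bruhat cells and parabolic subgroups -/

theorem image_initialSegment_eq_iff (w : Equiv.Perm (Fin n)) (i : ℕ) :
    w '' {k : Fin n | k.val < i} = {k : Fin n | k.val < i} ↔
      ∀ k : Fin n, k.val < i → (w k).val < i := by
  constructor
  · intro h k hk
    have : w k ∈ w '' {k : Fin n | k.val < i} := ⟨k, hk, rfl⟩
    rwa [h] at this
  · intro h
    refine Set.eq_of_subset_of_ncard_le ?_ ?_ (Set.toFinite _)
    · rintro _ ⟨k, hk, rfl⟩
      exact h k hk
    · rw [Set.ncard_image_of_injective _ w.injective]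

/-- A permutation matrix has a vanishing lower left block exactly if the permutation maps the
initial segment to itself. -/
theorem blockTriangular_le_permGL_iff (w : Equiv.Perm (Fin n)) (i : ℕ) :
    (permGL w : Matrix (Fin n) (Fin n) ℂ).BlockTriangular (fun k : Fin n => (i ≤ k.val : Prop)) ↔
      w '' {k : Fin n | k.val < i} = {k : Fin n | k.val < i} := by
  rw [blockTriangular_le_iff, image_initialSegment_eq_iff]
  constructor
  · intro h k hk
    by_contra hw
    have := h k (w k) hk (not_lt.1 hw)
    simp [permGL_apply] at this
  · intro h k j hk hj
    rw [permGL_apply, if_neg]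
    rintro rfl
    exact absurd (h k hk) (not_lt.2 hj)

/-- A permutation matrix has a vanishing upper right block exactly if the permutation maps the
initial segment to itself. -/
theorem blockTriangular_lt_permGL_iff (w : Equiv.Perm (Fin n)) (i : ℕ) :
    (permGL w : Matrix (Fin n) (Fin n) ℂ).BlockTriangular (fun k : Fin n => (k.val < i : Prop)) ↔
      w '' {k : Fin n | k.val < i} = {k : Fin n | k.val < i} := by
  have hinv : w '' {k : Fin n | k.val < i} = {k : Fin n | k.val < i} ↔
      (w⁻¹ : Equiv.Perm (Fin n)) '' {k : Fin n | k.val < i} = {k : Fin n | k.val < i} := by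
    constructor <;> intro h
    all_goals
      conv_lhs => rw [← h]
      simp [Set.image_image]
  rw [hinv, ← blockTriangular_le_permGL_iff, blockTriangular_lt_iff, blockTriangular_le_iff,
    ← transposeGL_permGL]
  rfl

theorem blockTriangular_of_mem_upperBorel {b : GL (Fin n) ℂ} (hb : b ∈ upperBorel n) (i : ℕ) :
    (b : Matrix (Fin n) (Fin n) ℂ).BlockTriangular (fun k : Fin n => (i ≤ k.val : Prop)) :=
  blockTriangular_le_iff.2 fun h j hh hj => hb (show h < j by rw [Fin.lt_def]; omega)

theorem blockTriangular_of_mem_lowerBorel {b : GL (Fin n) ℂ} (hb : b ∈ lowerBorel n) (i : ℕ) :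
    (b : Matrix (Fin n) (Fin n) ℂ).BlockTriangular (fun k : Fin n => (k.val < i : Prop)) :=
  blockTriangular_lt_iff.2 fun h j hh hj => hb (show h < j by rw [Fin.lt_def]; omega)

/-- Block-triangularity is constant on double cosets of a group of block-triangular matrices. -/
theorem blockTriangular_iff_of_mem_doubleCoset {α : Type*} [LinearOrder α] {β : Fin n → α}
    {H : Subgroup (GL (Fin n) ℂ)}
    (hH : ∀ b ∈ H, (b : Matrix (Fin n) (Fin n) ℂ).BlockTriangular β) {g w : GL (Fin n) ℂ}
    (hg : g ∈ DoubleCoset.doubleCoset w (H : Set (GL (Fin n) ℂ)) H) :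
    (g : Matrix (Fin n) (Fin n) ℂ).BlockTriangular β ↔
      (w : Matrix (Fin n) (Fin n) ℂ).BlockTriangular β := by
  obtain ⟨b, hb, b', hb', rfl⟩ := DoubleCoset.mem_doubleCoset.1 hg
  constructor
  · intro h
    have hw : w = b⁻¹ * (b * w * b') * b'⁻¹ := by group
    rw [hw, Units.val_mul, Units.val_mul]
    exact ((hH _ (inv_mem hb)).mul h).mul (hH _ (inv_mem hb'))
  · intro h
    rw [Units.val_mul, Units.val_mul]
    exact ((hH _ hb).mul h).mul (hH _ hb')

/-- In the double Bruhat cell of `u` and `v`, the block-triangular matrices are those for which `u`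
or `v` maps some initial segment to itself. -/
theorem isBlockTriangular_iff_of_mem_doubleBruhatCell {x : GL (Fin n) ℝ}
    {u v : Equiv.Perm (Fin n)}
    (hx : GeneralLinearGroup.map (algebraMap ℝ ℂ) x ∈ doubleBruhatCell u v) :
    ¬ IsBlockTriangular (x : Matrix (Fin n) (Fin n) ℝ) ↔
      FixesNoInitialSegment u ∧ FixesNoInitialSegment v := by
  have hu : ∀ i, (∀ h j : Fin n, h.val < i → i ≤ j.val →
      (x : Matrix (Fin n) (Fin n) ℝ) j h = 0) ↔
        u '' {k : Fin n | k.val < i} = {k : Fin n | k.val < i} := fun i => by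
    rw [← blockTriangular_le_permGL_iff, ← blockTriangular_iff_of_mem_doubleCoset
      (fun b hb => blockTriangular_of_mem_upperBorel hb i) hx.1, blockTriangular_le_iff]
    simp
  have hv : ∀ i, (∀ h j : Fin n, h.val < i → i ≤ j.val →
      (x : Matrix (Fin n) (Fin n) ℝ) h j = 0) ↔
        v '' {k : Fin n | k.val < i} = {k : Fin n | k.val < i} := fun i => by
    rw [← blockTriangular_lt_permGL_iff, ← blockTriangular_iff_of_mem_doubleCoset
      (fun b hb => blockTriangular_of_mem_lowerBorel hb i) hx.2, blockTriangular_lt_iff]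
    simp
  simp only [IsBlockTriangular, hu, hv, FixesNoInitialSegment]
  push Not
  exact ⟨fun h => ⟨fun i h1 h2 => (h i h1 h2).2, fun i h1 h2 => (h i h1 h2).1⟩,
    fun h i h1 h2 => ⟨h.2 i h1 h2, h.1 i h1 h2⟩⟩

end TotalPositivity

theorem mainTheorem8 (n : ℕ) (hn : 1 ≤ n) (x : GL (Fin n) ℝ)
    (hx : TotalPositivity.IsTotallyNonnegative (x : Matrix (Fin n) (Fin n) ℝ)) :
    List.TFAE [
      TotalPositivity.IsOscillatory (x : Matrix (Fin n) (Fin n) ℝ),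
      ∀ (i : ℕ) (hi : i + 1 < n),
        0 < (x : Matrix (Fin n) (Fin n) ℝ) ⟨i, Nat.lt_of_succ_lt hi⟩ ⟨i + 1, hi⟩ ∧
        0 < (x : Matrix (Fin n) (Fin n) ℝ) ⟨i + 1, hi⟩ ⟨i, Nat.lt_of_succ_lt hi⟩,
      TotalPositivity.IsTotallyPositive ((x : Matrix (Fin n) (Fin n) ℝ) ^ (n - 1)),
      ¬ TotalPositivity.IsBlockTriangular (x : Matrix (Fin n) (Fin n) ℝ),
      ∃ (l : ℕ) (w : Fin l → TotalPositivity.Letter n) (t : Fin l → ℝ),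
        (∀ k, 0 < t k) ∧
        (∀ i : Fin (n - 1), (∃ k, w k = .plain i) ∧ (∃ k, w k = .barred i)) ∧
        (x : Matrix (Fin n) (Fin n) ℝ) = TotalPositivity.productMap w t,
      ∃ u v : Equiv.Perm (Fin n),
        TotalPositivity.FixesNoInitialSegment u ∧ TotalPositivity.FixesNoInitialSegment v ∧
        Matrix.GeneralLinearGroup.map (algebraMap ℝ ℂ) x ∈
          TotalPositivity.doubleBruhatCell u v] := by
  open TotalPositivity in
  have hdet : (x : Matrix (Fin n) (Fin n) ℝ).det ≠ 0 :=
    ((Matrix.isUnit_iff_isUnit_det _).1 x.isUnit).ne_zero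
  -- a product with full support, as a list of letters and parameters
  have hlist : ∀ (l : ℕ) (w : Fin l → Letter n) (t : Fin l → ℝ), (∀ k, 0 < t k) →
      (∀ i : Fin (n - 1), (∃ k, w k = .plain i) ∧ (∃ k, w k = .barred i)) →
      (∀ p ∈ List.ofFn fun k => (w k, t k), 0 < p.2) ∧
        HasFullSupport (List.ofFn fun k => (w k, t k)) := by
    intro l w t ht hw
    refine ⟨fun p hp => ?_, fun i => ?_⟩
    · obtain ⟨k, rfl⟩ := (List.mem_ofFn' _ _).1 hp
      exact ht k
    · obtain ⟨⟨k, hk⟩, k', hk'⟩ := hw i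
      exact ⟨⟨_, (List.mem_ofFn' _ _).2 ⟨k, rfl⟩, hk⟩, _, (List.mem_ofFn' _ _).2 ⟨k', rfl⟩, hk'⟩
  tfae_have 4 → 5 := by
    intro h
    obtain ⟨L, hL, hxL⟩ := hx.isJacobiProduct hdet
    have hfull : HasFullSupport L := by
      by_contra hfull
      exact h (hxL ▸ isBlockTriangular_jacobiProd hfull)
    refine ⟨L.length, fun k => (L.get k).1, fun k => (L.get k).2, fun k => hL _ (L.get_mem k),
      fun i => ?_, ?_⟩
    · obtain ⟨⟨p, hp, hpi⟩, q, hq, hqi⟩ := hfull i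
      obtain ⟨k, rfl⟩ := List.get_of_mem hp
      obtain ⟨k', rfl⟩ := List.get_of_mem hq
      exact ⟨⟨k, hpi⟩, k', hqi⟩
    · rw [← jacobiProd_ofFn, hxL]
      exact congrArg jacobiProd (List.ofFn_get L).symm
  tfae_have 5 → 2 := by
    rintro ⟨l, w, t, ht, hw, hxw⟩ i hi
    obtain ⟨hpos, hfull⟩ := hlist l w t ht hw
    rw [hxw, ← jacobiProd_ofFn]
    exact ⟨jacobiProd_apply_pos hpos hfull (Or.inl rfl),
      jacobiProd_apply_pos hpos hfull (Or.inr rfl)⟩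
  tfae_have 2 → 4 := by
    rintro h ⟨i, hi, hin, h0 | h0⟩
    · have := (h (i - 1) (by omega)).1
      rw [h0 _ _ (by simp only; omega) (by simp only; omega)] at this
      exact lt_irrefl _ this
    · have := (h (i - 1) (by omega)).2
      rw [h0 _ _ (by simp only; omega) (by simp only; omega)] at this
      exact lt_irrefl _ this
  tfae_have 5 → 3 := by
    rintro ⟨l, w, t, ht, hw, hxw⟩
    obtain ⟨hpos, hfull⟩ := hlist l w t ht hw
    rw [hxw, ← jacobiProd_ofFn]
    exact isTotallyPositive_jacobiProd_pow hpos hfull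
  tfae_have 3 → 4 := fun h hb => hb.not_isTotallyPositive_pow _ h
  tfae_have 3 → 1 := by
    intro h
    rcases hn.eq_or_lt with rfl | hn
    · -- here `n - 1 = 0`, and the first power takes the place of the zeroth
      refine ⟨hx, 1, one_pos, fun k r c => ?_⟩
      have hk : k ≤ 1 := by simpa using Fintype.card_le_of_injective r r.injective
      rw [pow_one]
      refine lt_of_le_of_ne (hx k r c) (Ne.symm ?_)
      interval_cases k
      · simp
      · rw [Matrix.det_fin_one] at hdet ⊢
        simpa only [Matrix.submatrix_apply, Subsingleton.elim _ (0 : Fin 1)] using hdet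
    · exact ⟨hx, n - 1, by omega, h⟩
  tfae_have 1 → 4 := fun ⟨_, m, _, hm⟩ hb => hb.not_isTotallyPositive_pow m hm
  tfae_have 4 ↔ 6 := by
    constructor
    · intro h
      obtain ⟨u, hu⟩ := exists_mem_doubleCoset_upperBorel
        (Matrix.GeneralLinearGroup.map (algebraMap ℝ ℂ) x)
      obtain ⟨v, hv⟩ := exists_mem_doubleCoset_lowerBorel
        (Matrix.GeneralLinearGroup.map (algebraMap ℝ ℂ) x)
      have := (isBlockTriangular_iff_of_mem_doubleBruhatCell ⟨hu, hv⟩).1 h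
      exact ⟨u, v, this.1, this.2, hu, hv⟩
    · rintro ⟨u, v, hu, hv, h⟩
      exact (isBlockTriangular_iff_of_mem_doubleBruhatCell h).2 ⟨hu, hv⟩
  tfae_finish
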